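/- Let $\sigma>0$, let $X$ be a real random variable that is not almost surely constant (no other assumption is made on its law $P_X$), let $N\sim\mathcal N(0,\sigma^2)$ be independent of $X$, and let $Y=X+N$. Let $\phi_{\sigma^2}$ be the density of $\mathcal N(0,\sigma^2)$ and $f_Y(y)=\mathbb E[\phi_{\sigma^2}(y-X)]$ the density of $Y$. For every $y\in\mathbb R$ let $P_{X|Y=y}$ be given by Bayes' formula $P_{X|Y=y}(dx)=\frac{\phi_{\sigma^2}(y-x)}{f_Y(y)}P_X(dx)$ (this is a version of the regular conditional distribution of $X$ given $Y$). Put $\hat X(y)=\mathbb E[X\mid Y=y]=\int x\,P_{X|Y=y}(dx)$ and, for $k\ge 1$, $$\kappa_{X|Y=y}(k)=\frac{d^k}{dt^k}\log \mathbb E[e^{tX}\mid Y=y]\Big|_{t=0}.$$ Theorem. The function $\hat X:\mathbb R\to\mathbb R$ is strictly increasing, and its inverse $\hat X^{-1}$, defined on the range of $\hat X$, is real-analytic. Moreover, for every $a\in\mathbb R$ one has $\kappa_{X|Y=a}(2)>0$, and there exists $\tau>0$ (depending on $\sigma$, $a$ and the law of $X$) such that every $x$ with $|x-\hat X(a)|<\tau$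 lies in the range of $\hat X$ and $$\hat X^{-1}(x)=a+\sum_{n=1}^\infty b_n\frac{(x-\hat X(a))^n}{n!},$$ where $$b_1=\frac{\sigma^2}{\kappa_{X|Y=a}(2)},\qquad b_n=b_1^n\sum_{k=1}^{n-1}(-1)^k\,n^{(k)}\,\mathsf B_{n-1,k}(c_1,\dots,c_{n-k})\quad(n\ge2),$$ $$c_k=\frac{\kappa_{X|Y=a}(k+2)}{(k+1)\,\sigma^{2k}\,\kappa_{X|Y=a}(2)}\quad(k\ge1).$$ Here $n^{(k)}=n(n+1)\cdots(n+k-1)$ is the rising factorial and $$\mathsf B_{n,k}(x_1,\dots,x_{n-k+1})=\sum\frac{n!}{j_1!\,j_2!\cdots}\Big(\frac{x_1}{1!}\Big)^{j_1}\Big(\frac{x_2}{2!}\Big)^{j_2}\cdots,$$ the sum running over all integers $j_1,j_2,\ldots\ge0$ with $\sum_i j_i=k$ and $\sum_i i\,j_i=n$, is the partial Bell polynomial. -/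

import Mathlib

open MeasureTheory ProbabilityTheory
open scoped NNReal ENNReal Nat

noncomputable section

/-- The density `f_Y(y) = E[φ_{σ²}(y - X)]` of `Y = X + N`, where `X ∼ P` and `N ∼ 𝓝(0, σ²)` are
independent. (`gaussianPDFReal x v y` is the density at `y` of the normal law with mean `x` and
variance `v`.) -/
def outputDensity (P : Measure ℝ) (σ : ℝ≥0) (y : ℝ) : ℝ :=
  ∫ x, gaussianPDFReal x (σ ^ 2) y ∂P

/-- The conditional distribution `P_{X|Y=y}` of `X` given `Y = X + N = y`, defined for every real
`y` by Bayes' formula `P_{X|Y=y}(dx) = φ_{σ²}(y - x) / f_Y(y) P_X(dx)`. -/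
def condLaw (P : Measure ℝ) (σ : ℝ≥0) (y : ℝ) : Measure ℝ :=
  P.withDensity fun x => ENNReal.ofReal (gaussianPDFReal x (σ ^ 2) y / outputDensity P σ y)

theorem measurable_gaussianPDFReal_left (σ : ℝ≥0) (y : ℝ) :
    Measurable fun x => gaussianPDFReal x (σ ^ 2) y :=
  measurable_uncurry_gaussianPDFReal.comp
    (measurable_id.prodMk (measurable_const.prodMk measurable_const))

theorem gaussianPDFReal_le (x : ℝ) (v : ℝ≥0) (y : ℝ) :
    gaussianPDFReal x v y ≤ (Real.sqrt (2 * Real.pi * v))⁻¹ := by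
  rw [gaussianPDFReal]
  refine mul_le_of_le_one_right (by positivity) (Real.exp_le_one_iff.2 ?_)
  have : 0 ≤ (y - x) ^ 2 / (2 * (v : ℝ)) := by positivity
  rw [neg_div]; linarith

theorem integrable_gaussianPDFReal_left (P : Measure ℝ) [IsFiniteMeasure P] (σ : ℝ≥0) (y : ℝ) :
    Integrable (fun x => gaussianPDFReal x (σ ^ 2) y) P :=
  Integrable.of_bound (measurable_gaussianPDFReal_left σ y).aestronglyMeasurable
    (Real.sqrt (2 * Real.pi * (σ ^ 2 : ℝ≥0)))⁻¹ (Filter.Eventually.of_forall fun x => by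
      rw [Real.norm_of_nonneg (gaussianPDFReal_nonneg _ _ _)]
      exact gaussianPDFReal_le x _ y)

/-- `f_Y` is positive everywhere. -/
theorem outputDensity_pos (P : Measure ℝ) [IsProbabilityMeasure P] {σ : ℝ≥0} (hσ : 0 < σ)
    (y : ℝ) : 0 < outputDensity P σ y := by
  have hv : σ ^ 2 ≠ 0 := pow_ne_zero 2 hσ.ne'
  have hpos : ∀ x, 0 < gaussianPDFReal x (σ ^ 2) y := fun x => gaussianPDFReal_pos x _ y hv
  unfold outputDensity
  rw [integral_pos_iff_support_of_nonneg (fun x => (hpos x).le) (integrable_gaussianPDFReal_left P σ y)]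
  have : Function.support (fun x => gaussianPDFReal x (σ ^ 2) y) = Set.univ := by
    ext x; simpa using (hpos x).ne'
  simp [this]

/-- `P_{X|Y=y}` is a probability measure for every real `y`. -/
theorem isProbabilityMeasure_condLaw (P : Measure ℝ) [IsProbabilityMeasure P] {σ : ℝ≥0}
    (hσ : 0 < σ) (y : ℝ) : IsProbabilityMeasure (condLaw P σ y) := by
  constructor
  rw [condLaw, withDensity_apply _ MeasurableSet.univ, Measure.restrict_univ,
    ← ofReal_integral_eq_lintegral_ofReal]
  · rw [integral_div]
    change ENNReal.ofReal (outputDensity P σ y / _) = 1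
    rw [div_self (outputDensity_pos P hσ y).ne', ENNReal.ofReal_one]
  · exact (integrable_gaussianPDFReal_left P σ y).div_const _
  · exact Filter.Eventually.of_forall fun x =>
      div_nonneg (gaussianPDFReal_nonneg _ _ _) (outputDensity_pos P hσ y).le

/-- All exponential moments of `P_{X|Y=y}` are finite. -/
theorem integrable_exp_condLaw (P : Measure ℝ) [IsProbabilityMeasure P] {σ : ℝ≥0} (hσ : 0 < σ)
    (y t : ℝ) : Integrable (fun x => Real.exp (t * x)) (condLaw P σ y) := by
  have hf := outputDensity_pos P hσ y
  have hs : (0 : ℝ) < (σ : ℝ) ^ 2 := by positivity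
  have hm : Measurable fun x => gaussianPDFReal x (σ ^ 2) y / outputDensity P σ y :=
    (measurable_gaussianPDFReal_left σ y).div_const _
  rw [condLaw, integrable_withDensity_iff hm.ennreal_ofReal
    (Filter.Eventually.of_forall fun x => ENNReal.ofReal_lt_top)]
  refine Integrable.of_bound
    ((by fun_prop : Measurable fun x : ℝ => Real.exp (t * x)).mul
      hm.ennreal_ofReal.ennreal_toReal).aestronglyMeasurable
    (Real.exp (t * y + t ^ 2 * σ ^ 2 / 2) *
      ((Real.sqrt (2 * Real.pi * (σ ^ 2 : ℝ≥0)))⁻¹ / outputDensity P σ y))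
    (Filter.Eventually.of_forall fun x => ?_)
  have h0 : 0 ≤ gaussianPDFReal x (σ ^ 2) y / outputDensity P σ y :=
    div_nonneg (gaussianPDFReal_nonneg _ _ _) hf.le
  rw [ENNReal.toReal_ofReal h0, Real.norm_of_nonneg (mul_nonneg (Real.exp_pos _).le h0),
    mul_div_assoc', mul_div_assoc']
  refine div_le_div_of_nonneg_right ?_ hf.le
  rw [gaussianPDFReal, mul_left_comm, ← Real.exp_add, mul_comm]
  refine mul_le_mul_of_nonneg_right (Real.exp_le_exp.2 ?_) (by positivity)
  have : t * x + -(y - x) ^ 2 / (2 * ((σ ^ 2 : ℝ≥0) : ℝ)) = t * y + t ^ 2 * σ ^ 2 / 2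
      - (y - x + t * σ ^ 2) ^ 2 / (2 * (σ : ℝ) ^ 2) := by
    push_cast; field_simp; ring
  rw [this]
  have : 0 ≤ (y - x + t * (σ : ℝ) ^ 2) ^ 2 / (2 * (σ : ℝ) ^ 2) := by positivity
  linarith

/-- The conditional mean `E[X | Y = y] = ∫ x dP_{X|Y=y}(x)`. -/
def condMean (P : Measure ℝ) (σ : ℝ≥0) (y : ℝ) : ℝ :=
  ∫ x, x ∂(condLaw P σ y)

/-- The conditional cumulant `κ_{X|Y=y}(k)`: the `k`-th derivative at `t = 0` of the conditional
cumulant generating function `t ↦ log E[exp (t X) | Y = y]`. -/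
def condCumulant (P : Measure ℝ) (σ : ℝ≥0) (y : ℝ) (k : ℕ) : ℝ :=
  iteratedDeriv k (cgf id (condLaw P σ y)) 0

/-- The partial Bell polynomial `B_{n,k}(x₁, x₂, …)`: the sum of
`n! / (j₁! j₂! ⋯) * (x₁ / 1!) ^ j₁ * (x₂ / 2!) ^ j₂ * ⋯` over all `j₁, j₂, … ≥ 0` with
`j₁ + j₂ + ⋯ = k` and `1 j₁ + 2 j₂ + ⋯ = n`. These conditions force `j_i = 0` for `i > n` (and
for `i > n - k + 1`), so that only the indices `1 ≤ i ≤ n` are listed. -/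
def partialBell (n k : ℕ) (x : ℕ → ℝ) : ℝ :=
  ∑ j ∈ (Finset.piAntidiag (Finset.Icc 1 n) k).filter
      (fun j => ∑ i ∈ Finset.Icc 1 n, i * j i = n),
    (n ! : ℝ) * ∏ i ∈ Finset.Icc 1 n, (x i / (i ! : ℝ)) ^ j i / ((j i)! : ℝ)

/-- `c_k = κ_{X|Y=a}(k+2) / ((k+1) σ^{2k} κ_{X|Y=a}(2))`, used for `k ≥ 1`. -/
def invAux (P : Measure ℝ) (σ : ℝ≥0) (a : ℝ) (k : ℕ) : ℝ :=
  condCumulant P σ a (k + 2) / (((k : ℝ) + 1) * (σ : ℝ) ^ (2 * k) * condCumulant P σ a 2)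

/-- `b₁ = σ² / κ_{X|Y=a}(2)` and
`b_n = b₁ⁿ ∑_{k=1}^{n-1} (-1)ᵏ n^{(k)} B_{n-1,k}(c₁, c₂, …)` for `n ≥ 2`, with the rising factorial
`n^{(k)} = n (n+1) ⋯ (n+k-1)`. The value at `n = 0` is not used. -/
def invCoeff (P : Measure ℝ) (σ : ℝ≥0) (a : ℝ) (n : ℕ) : ℝ :=
  if n = 1 then (σ : ℝ) ^ 2 / condCumulant P σ a 2
  else ((σ : ℝ) ^ 2 / condCumulant P σ a 2) ^ n *
    ∑ k ∈ Finset.Icc 1 (n - 1),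
      (-1 : ℝ) ^ k * (n.ascFactorial k : ℝ) * partialBell (n - 1) k (invAux P σ a)

end

/-! ### Lagrange inversion for formal power series -/

section FormalInversion

open PowerSeries

variable {K : Type*} [Field K]

/-! Expanding the square in the Gaussian density shows that `P_{X|Y=y}` is `P_{X|Y=0}` tilted by
`exp (y x / σ²)`, up to normalisation. All these laws thus form one exponential family. With `K` the
cumulant generating function at `y = 0`, which is analytic on all of `ℝ` because the Gaussian factor
makes every exponential moment finite, the `k`-th cumulant at `y` is `K⁽ᵏ⁾(y / σ²)` and the
conditional mean is `K'(y / σ²)` (`condCumulant_eq`, `condMean_eq`).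

Hence the conditional mean is analytic, and its derivative is the conditional variance over `σ²`.
This is positive since `X` is not constant, so the mean is strictly increasing and has an analytic
inverse.

The Taylor coefficients of the inverse come from Lagrange inversion, proved formally by a residue
computation (`lagrange_inversion`). Writing the series to invert as `d X (1 + H)`, the negative
binomial series expands `(1 + H)⁻¹ ^ (n + 1)` in powers of `H`, whose coefficients are partial Bell
polynomials. Comparing Taylor series carries the result over to analytic functions
(`iteratedDeriv_leftInverse`). -/

theorem PowerSeries.coeff_X_pow_mul_of_lt {R : Type*} [Semiring R] (p : PowerSeries R) {n d : ℕ}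
    (h : d < n) : coeff d (X ^ n * p) = 0 := by
  rw [coeff_X_pow_mul', if_neg (by omega)]

/-- The residue of `F ^ (-m - 1) * F'` for `F = X * u`, written without Laurent series. -/
theorem PowerSeries.coeff_inv_pow_mul_derivative [CharZero K] (u : K⟦X⟧)
    (hu : constantCoeff u ≠ 0) (m : ℕ) :
    coeff m (u⁻¹ ^ (m + 1) * d⁄dX K (X * u)) = if m = 0 then 1 else 0 := by
  have huv : u⁻¹ * u = 1 := PowerSeries.inv_mul_cancel u hu
  have hd : d⁄dX K u⁻¹ = -u⁻¹ ^ 2 * d⁄dX K u := derivative_inv' u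
  have hX : d⁄dX K (X * u) = u + X * d⁄dX K u := by
    rw [Derivation.leibniz]; simp [add_comm]
  rcases m with _ | m
  · rw [hX]
    have : u⁻¹ ^ (0 + 1) * (u + X * d⁄dX K u) = 1 + X * (u⁻¹ * d⁄dX K u) := by
      linear_combination huv
    rw [this]; simp
  · have hp : d⁄dX K (u⁻¹ ^ (m + 1)) = -(C ((m : K) + 1)) * (u⁻¹ ^ (m + 2) * d⁄dX K u) := by
      rw [derivative_pow, hd]
      simp only [map_add, map_natCast, map_one, Nat.cast_add, Nat.cast_one, Nat.add_sub_cancel]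
      ring
    -- A derivative has no residue: `X * d/dX` multiplies the coefficient of degree `m + 1` by `m +
    -- 1`, so the two terms on the right cancel in that degree.
    have key : C ((m : K) + 1) * (u⁻¹ ^ (m + 1 + 1) * d⁄dX K (X * u)) =
        C ((m : K) + 1) * u⁻¹ ^ (m + 1) - X * d⁄dX K (u⁻¹ ^ (m + 1)) := by
      rw [hX, hp]
      linear_combination C ((m : K) + 1) * u⁻¹ ^ (m + 1) * huv
    have h2 := congrArg (coeff (m + 1)) key
    rw [coeff_C_mul, map_sub, coeff_C_mul, coeff_succ_X_mul, coeff_derivative] at h2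
    have hm : (m : K) + 1 ≠ 0 := by exact_mod_cast Nat.succ_ne_zero m
    have h3 : ((m : K) + 1) * coeff (m + 1) (u⁻¹ ^ (m + 1 + 1) * d⁄dX K (X * u)) = 0 := by
      rw [h2]; ring
    simpa [hm] using h3

/-- **Lagrange inversion**: if `G` is a left inverse of `F = X * u` under composition, up to
order `n`, then `n [X ^ n] G = [X ^ (n - 1)] u ^ (-n)`. -/
theorem PowerSeries.lagrange_inversion [CharZero K] (u R : K⟦X⟧) (hu : constantCoeff u ≠ 0)
    (g : ℕ → K) (n : ℕ)
    (h : (X : K⟦X⟧) =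
      ∑ k ∈ Finset.range (n + 2), C (g k) * (X * u) ^ k + (X * u) ^ (n + 2) * R) :
    ((n : K) + 1) * g (n + 1) = coeff n (u⁻¹ ^ (n + 1)) := by
  have huv : u⁻¹ * u = 1 := PowerSeries.inv_mul_cancel u hu
  have huvp (k : ℕ) : u⁻¹ ^ k * u ^ k = 1 := by rw [← mul_pow, huv, one_pow]
  have hd := congrArg (d⁄dX K) h
  rw [derivative_X, map_add, map_sum] at hd
  -- This coefficient is the residue of the differentiated identity divided by `(X * u) ^ (n + 1)`;
  -- only the term `k = n + 1` survives.
  have h1 := congrArg (fun p => coeff n (u⁻¹ ^ (n + 1) * p)) hd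
  simp only [mul_one, mul_add, Finset.mul_sum, map_add, map_sum] at h1
  have hR : coeff n (u⁻¹ ^ (n + 1) * d⁄dX K ((X * u) ^ (n + 2) * R)) = 0 := by
    have : u⁻¹ ^ (n + 1) * d⁄dX K ((X * u) ^ (n + 2) * R) =
        X ^ (n + 1) * (u⁻¹ ^ (n + 1) * (u ^ (n + 2) * X * d⁄dX K R +
          R * (((n + 2 : ℕ) : K⟦X⟧) * u ^ (n + 1) * d⁄dX K (X * u)))) := by
      rw [Derivation.leibniz, derivative_pow]
      simp only [smul_eq_mul, Nat.add_succ_sub_one]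
      ring
    rw [this, coeff_X_pow_mul_of_lt _ (by omega)]
  rw [hR, add_zero, Finset.sum_eq_single (n + 1)] at h1
  · rw [h1]
    have : u⁻¹ ^ (n + 1) * d⁄dX K (C (g (n + 1)) * (X * u) ^ (n + 1)) =
        C (((n : K) + 1) * g (n + 1)) * (X ^ n * (u⁻¹ ^ (0 + 1) * d⁄dX K (X * u))) := by
      rw [Derivation.leibniz, derivative_pow, derivative_C]
      simp only [smul_eq_mul, Nat.add_succ_sub_one, map_mul, map_add, map_natCast, map_one]
      push_cast
      linear_combination (C (g (n+1)) * ((n : K⟦X⟧) + 1) * X ^ n * u⁻¹ * d⁄dX K (X * u)) * huvp n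
    rw [this, coeff_C_mul]
    have h0 := coeff_X_pow_mul (u⁻¹ ^ (0 + 1) * d⁄dX K (X * u)) n 0
    rw [zero_add] at h0
    rw [h0, coeff_inv_pow_mul_derivative u hu]; simp
  · intro k hk hkn
    rw [Finset.mem_range] at hk
    rcases k with _ | k
    · simp
    · obtain ⟨m, rfl⟩ : ∃ m, n = k + (m + 1) := ⟨n - k - 1, by omega⟩
      have : u⁻¹ ^ (k + (m + 1) + 1) * d⁄dX K (C (g (k + 1)) * (X * u) ^ (k + 1)) =
          C (((k : K) + 1) * g (k + 1)) *
            (X ^ k * (u⁻¹ ^ (m + 1 + 1) * d⁄dX K (X * u))) := by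
        rw [Derivation.leibniz, derivative_pow, derivative_C]
        simp only [smul_eq_mul, Nat.add_succ_sub_one, map_mul, map_add, map_natCast, map_one]
        push_cast
        linear_combination
          (C (g (k+1)) * ((k : K⟦X⟧) + 1) * X ^ k * u⁻¹ ^ (m + 2) * d⁄dX K (X * u)) * huvp k
      rw [this, coeff_C_mul]
      have h0 := coeff_X_pow_mul (u⁻¹ ^ (m + 1 + 1) * d⁄dX K (X * u)) k (m + 1)
      rw [add_comm (m + 1)] at h0
      rw [h0, coeff_inv_pow_mul_derivative u hu]; simp
  · intro hn; simp at hn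

/-- The negative binomial series, coefficientwise. -/
theorem PowerSeries.coeff_inv_one_add_pow (H : K⟦X⟧) (hH : constantCoeff H = 0) (n : ℕ) :
    coeff n ((1 + H)⁻¹ ^ (n + 1)) =
      ∑ k ∈ Finset.range (n + 1), (-1) ^ k * ((n + k).choose n : K) * coeff n (H ^ k) := by
  have hs : HasSubst (-H) := HasSubst.of_constantCoeff_zero' (by simp [hH])
  have h1 : constantCoeff (1 + H) ≠ 0 := by simp [hH]
  -- Substitute `-H` for `X` in the expansion of `(1 - X)⁻¹ ^ (n + 1)`.
  have hmul : (mk fun k => ((n + k).choose n : K)) * (1 - X) ^ (n + 1) = 1 :=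
    mk_add_choose_mul_one_sub_pow_eq_one K n
  have hmul' := congrArg (substAlgHom (R := K) hs) hmul
  rw [map_mul, map_pow, map_sub, map_one, substAlgHom_X, sub_neg_eq_add] at hmul'
  have hinv : (1 + H)⁻¹ ^ (n + 1) = substAlgHom (R := K) hs
      (mk fun k => ((n + k).choose n : K)) := by
    have h2 : (1 + H) ^ (n + 1) * (1 + H)⁻¹ ^ (n + 1) = 1 := by
      rw [← mul_pow, PowerSeries.mul_inv_cancel _ h1, one_pow]
    exact (left_inv_eq_right_inv hmul' h2).symm
  rw [hinv, coe_substAlgHom, coeff_subst' hs,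
    finsum_eq_sum_of_support_subset (s := Finset.range (n + 1))]
  · refine Finset.sum_congr rfl fun k _ => ?_
    rw [neg_pow, coeff_mk, smul_eq_mul, show ((-1 : K⟦X⟧) ^ k) = C ((-1) ^ k) by simp, coeff_C_mul]
    ring
  · intro k hk
    by_contra hk'
    have hk'' : n < k := by simpa using hk'
    obtain ⟨q, hq⟩ := X_dvd_iff.2 hH
    apply hk
    dsimp only
    rw [neg_pow, hq, mul_pow, mul_left_comm, coeff_X_pow_mul_of_lt _ hk'', smul_zero]

end FormalInversion

/-! ### Partial Bell polynomials -/

open PowerSeries in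
/-- Partial Bell polynomials are the coefficients of the powers of an exponential generating
function. -/
theorem coeff_mk_pow_eq_partialBell (c : ℕ → ℝ) (H : PowerSeries ℝ) (n k : ℕ)
    (hH0 : constantCoeff H = 0)
    (hH : ∀ i, i ≠ 0 → coeff i H = c i / (i ! : ℝ)) :
    coeff n (H ^ k) = (k ! : ℝ) / (n ! : ℝ) * partialBell n k c := by
  -- Only `H` modulo `X ^ (n + 1)` matters, so the multinomial theorem for a finite sum suffices.
  obtain ⟨Q, hQ⟩ : ∃ Q, H = ∑ i ∈ Finset.Icc 1 n, C (c i / i.factorial) * X ^ i + X ^ (n + 1) * Q := by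
    have hdvd : X ^ (n + 1) ∣
        H - ∑ i ∈ Finset.Icc 1 n, C (c i / i.factorial) * (X : PowerSeries ℝ) ^ i := by
      rw [X_pow_dvd_iff]
      intro m hm
      rw [map_sub, map_sum]
      simp only [coeff_C_mul, coeff_X_pow, mul_ite, mul_one, mul_zero]
      rw [Finset.sum_ite_eq]
      rcases m with _ | m
      · simpa using hH0
      · rw [if_pos (by simp; omega), hH _ (by omega), sub_self]
    obtain ⟨Q, hQ⟩ := hdvd
    exact ⟨Q, by rw [← hQ]; ring⟩
  obtain ⟨S, hS⟩ : ∃ S, H ^ k = (∑ i ∈ Finset.Icc 1 n, C (c i / i.factorial) * X ^ i) ^ k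
      + X ^ (n + 1) * S := by
    obtain ⟨S, hS⟩ := sub_dvd_pow_sub_pow H (∑ i ∈ Finset.Icc 1 n, C (c i / i.factorial) * X ^ i) k
    refine ⟨Q * S, ?_⟩
    have : H - ∑ i ∈ Finset.Icc 1 n, C (c i / i.factorial) * X ^ i = X ^ (n + 1) * Q := by
      rw [sub_eq_iff_eq_add']; exact hQ
    rw [← mul_assoc, ← this, ← hS]; ring
  rw [hS, map_add, coeff_X_pow_mul_of_lt _ (Nat.lt_succ_self n), add_zero,
    Finset.sum_pow_eq_sum_piAntidiag, map_sum, partialBell, Finset.mul_sum, Finset.sum_filter]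
  refine Finset.sum_congr rfl fun j hj => ?_
  rw [Finset.mem_piAntidiag] at hj
  have hprod : ∏ i ∈ Finset.Icc 1 n, (C (c i / (i ! : ℝ)) * X ^ i) ^ j i =
      C (∏ i ∈ Finset.Icc 1 n, (c i / (i ! : ℝ)) ^ j i) *
        (X : PowerSeries ℝ) ^ (∑ i ∈ Finset.Icc 1 n, i * j i) := by
    simp_rw [mul_pow, Finset.prod_mul_distrib, ← pow_mul, Finset.prod_pow_eq_pow_sum, map_prod,
      map_pow]
  have hmult : (Nat.multinomial (Finset.Icc 1 n) j : ℝ) =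
      (k ! : ℝ) / ∏ i ∈ Finset.Icc 1 n, ((j i)! : ℝ) := by
    rw [eq_div_iff (Finset.prod_ne_zero_iff.2 fun i _ => by positivity), mul_comm]
    have := Nat.multinomial_spec (Finset.Icc 1 n) j
    rw [hj.1] at this
    exact_mod_cast this
  rw [hprod, show ((Nat.multinomial (Finset.Icc 1 n) j : ℕ) : PowerSeries ℝ) =
    C (Nat.multinomial (Finset.Icc 1 n) j : ℝ) by simp, coeff_C_mul, coeff_C_mul, coeff_X_pow]
  by_cases h : ∑ i ∈ Finset.Icc 1 n, i * j i = n
  · rw [if_pos h, if_pos h.symm, hmult, Finset.prod_div_distrib]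
    field_simp
  · rw [if_neg h, if_neg (Ne.symm h)]; simp

theorem partialBell_zero_right {n : ℕ} (hn : n ≠ 0) (c : ℕ → ℝ) : partialBell n 0 c = 0 := by
  rw [partialBell, Finset.piAntidiag_zero, Finset.sum_filter, Finset.sum_singleton, if_neg]
  simpa using hn.symm

theorem partialBell_zero_zero (c : ℕ → ℝ) : partialBell 0 0 c = 1 := by
  simp [partialBell]

open PowerSeries in
/-- Lagrange inversion in terms of partial Bell polynomials. -/
theorem lagrange_inversion_partialBell (F R : PowerSeries ℝ) (hF0 : constantCoeff F = 0)
    (d : ℝ) (hd : d ≠ 0) (hF1 : coeff 1 F = d) (c : ℕ → ℝ)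
    (hF : ∀ i, i ≠ 0 → coeff (i + 1) F = d * (c i / (i ! : ℝ))) (g : ℕ → ℝ) (n : ℕ)
    (h : (X : PowerSeries ℝ) = ∑ k ∈ Finset.range (n + 2), C (g k) * F ^ k + F ^ (n + 2) * R) :
    ((n + 1)! : ℝ) * g (n + 1) = d⁻¹ ^ (n + 1) * ∑ k ∈ Finset.range (n + 1),
      (-1 : ℝ) ^ k * ((n + 1).ascFactorial k : ℝ) * partialBell n k c := by
  obtain ⟨u, rfl⟩ := X_dvd_iff.2 hF0
  have hu (i : ℕ) : coeff (i + 1) (X * u) = coeff i u := coeff_succ_X_mul i u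
  have hu0 : constantCoeff u = d := by
    rw [← hF1, ← coeff_zero_eq_constantCoeff_apply, ← hu]
  have hL := lagrange_inversion u R (by rwa [hu0]) g n h
  set H : PowerSeries ℝ := C d⁻¹ * u - 1 with hHdef
  have hH0 : constantCoeff H = 0 := by simp [hHdef, hu0, hd]
  have hHu : u = C d * (1 + H) := by
    rw [hHdef, add_sub_cancel, ← mul_assoc, ← map_mul, mul_inv_cancel₀ hd, map_one, one_mul]
  have hH (i : ℕ) (hi : i ≠ 0) : coeff i H = c i / (i ! : ℝ) := by
    rw [hHdef, map_sub, coeff_C_mul, ← hu, hF i hi, coeff_one, if_neg hi]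
    field_simp; simp
  have hinv : u⁻¹ ^ (n + 1) = C (d⁻¹ ^ (n + 1)) * (1 + H)⁻¹ ^ (n + 1) := by
    rw [hHu, PowerSeries.mul_inv_rev, C_inv, mul_pow, map_pow, mul_comm]
  rw [hinv, coeff_C_mul, coeff_inv_one_add_pow H hH0] at hL
  rw [Nat.factorial_succ, Nat.cast_mul, mul_comm ((n + 1 : ℕ) : ℝ), mul_assoc]
  push_cast
  rw [hL, mul_left_comm, Finset.mul_sum]
  congr 1
  refine Finset.sum_congr rfl fun k _ => ?_
  -- The rising factorial arises as `k! * (n + k).choose n`.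
  rw [coeff_mk_pow_eq_partialBell c H n k hH0 hH, Nat.ascFactorial_eq_factorial_mul_choose,
    Nat.choose_symm_add]
  have : (n ! : ℝ) ≠ 0 := by positivity
  push_cast
  field_simp

/-! ### From formal series to analytic functions -/

section TaylorSeries

open PowerSeries Topology

/-- The Taylor series at `0` of a real function, as a formal power series. -/
noncomputable def taylorPowerSeries (f : ℝ → ℝ) : PowerSeries ℝ :=
  PowerSeries.mk fun n => iteratedDeriv n f 0 / (n ! : ℝ)

theorem coeff_taylorPowerSeries (f : ℝ → ℝ) (n : ℕ) :
    coeff n (taylorPowerSeries f) = iteratedDeriv n f 0 / (n ! : ℝ) := coeff_mk _ _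

theorem taylorPowerSeries_congr {f g : ℝ → ℝ} (h : f =ᶠ[𝓝 0] g) :
    taylorPowerSeries f = taylorPowerSeries g := by
  ext n
  rw [coeff_taylorPowerSeries, coeff_taylorPowerSeries, (h.iteratedDeriv n).eq_of_nhds]

theorem taylorPowerSeries_add {f g : ℝ → ℝ} (hf : AnalyticAt ℝ f 0) (hg : AnalyticAt ℝ g 0) :
    taylorPowerSeries (f + g) = taylorPowerSeries f + taylorPowerSeries g := by
  ext n
  simp only [map_add, coeff_taylorPowerSeries]
  rw [iteratedDeriv_add hf.contDiffAt hg.contDiffAt, add_div]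

theorem taylorPowerSeries_mul {f g : ℝ → ℝ} (hf : AnalyticAt ℝ f 0) (hg : AnalyticAt ℝ g 0) :
    taylorPowerSeries (f * g) = taylorPowerSeries f * taylorPowerSeries g := by
  ext n
  rw [coeff_mul, coeff_taylorPowerSeries, iteratedDeriv_mul hf.contDiffAt hg.contDiffAt,
    Finset.Nat.sum_antidiagonal_eq_sum_range_succ_mk, Finset.sum_div]
  refine Finset.sum_congr rfl fun i hi => ?_
  rw [coeff_taylorPowerSeries, coeff_taylorPowerSeries,
    Nat.cast_choose ℝ (Nat.lt_succ_iff.1 (Finset.mem_range.1 hi))]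
  have : (n ! : ℝ) ≠ 0 := by positivity
  field_simp

theorem taylorPowerSeries_const (c : ℝ) : taylorPowerSeries (fun _ => c) = C c := by
  ext n
  rw [coeff_taylorPowerSeries, iteratedDeriv_const, coeff_C]
  rcases n with _ | n <;> simp

theorem taylorPowerSeries_id : taylorPowerSeries (fun x => x) = X := by
  ext n
  rw [coeff_taylorPowerSeries, iteratedDeriv_fun_id_zero, coeff_X]
  split_ifs with h
  · subst h; simp
  · simp

theorem taylorPowerSeries_pow {f : ℝ → ℝ} (hf : AnalyticAt ℝ f 0) (n : ℕ) :
    taylorPowerSeries (f ^ n) = taylorPowerSeries f ^ n := by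
  induction n with
  | zero => rw [pow_zero, pow_zero]; exact (taylorPowerSeries_const 1).trans (map_one _)
  | succ n ih => rw [pow_succ, taylorPowerSeries_mul (hf.pow n) hf, ih, pow_succ]

theorem taylorPowerSeries_sum {ι : Type*} (s : Finset ι) {f : ι → ℝ → ℝ}
    (hf : ∀ i ∈ s, AnalyticAt ℝ (f i) 0) :
    taylorPowerSeries (∑ i ∈ s, f i) = ∑ i ∈ s, taylorPowerSeries (f i) := by
  classical
  induction s using Finset.induction_on with
  | empty =>
    rw [Finset.sum_empty, Finset.sum_empty]
    exact (taylorPowerSeries_const 0).trans (map_zero _)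
  | insert i s hi ih =>
    rw [Finset.sum_insert hi, Finset.sum_insert hi, taylorPowerSeries_add
      (hf i (Finset.mem_insert_self i s))
      (Finset.analyticAt_sum _ fun j hj => hf j (Finset.mem_insert_of_mem hj)),
      ih fun j hj => hf j (Finset.mem_insert_of_mem hj)]

/-- The derivatives at `0` of a local inverse of an analytic function that fixes `0`. -/
theorem iteratedDeriv_leftInverse_zero {F G : ℝ → ℝ} (hF : AnalyticAt ℝ F 0)
    (hG : AnalyticAt ℝ G 0) (hF0 : F 0 = 0) (hF' : deriv F 0 ≠ 0)
    (hGF : ∀ᶠ z in 𝓝 0, G (F z) = z) (c : ℕ → ℝ)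
    (hc : ∀ i, i ≠ 0 → iteratedDeriv (i + 1) F 0 = deriv F 0 * ((i + 1) * c i)) (n : ℕ) :
    iteratedDeriv (n + 1) G 0 = (deriv F 0)⁻¹ ^ (n + 1) * ∑ k ∈ Finset.range (n + 1),
      (-1 : ℝ) ^ k * ((n + 1).ascFactorial k : ℝ) * partialBell n k c := by
  -- A finite expansion of `G` with analytic remainder: composing with `F` then needs only sums and
  -- products of Taylor series.
  obtain ⟨R, hR, hGR⟩ := hG.exists_eq_sum_add_pow_mul (n + 2)
  have hRF : AnalyticAt ℝ (R ∘ F) 0 := AnalyticAt.comp (by rwa [hF0]) hF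
  have hfun : (fun z : ℝ => z) =ᶠ[𝓝 0]
      (∑ k ∈ Finset.range (n + 2), (fun _ => iteratedDeriv k G 0 / (k ! : ℝ)) * F ^ k) +
        F ^ (n + 2) * (R ∘ F) := by
    filter_upwards [hGF] with z hz
    conv_lhs => rw [← hz, hGR]
    simp only [Pi.add_apply, Finset.sum_apply, Pi.mul_apply, Pi.pow_apply, Function.comp_apply,
      smul_eq_mul]
    congr 1
    exact Finset.sum_congr rfl fun k _ => by ring
  have hterm (k : ℕ) : AnalyticAt ℝ ((fun _ => iteratedDeriv k G 0 / (k ! : ℝ)) * F ^ k) 0 :=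
    analyticAt_const.mul (hF.pow k)
  have hser := taylorPowerSeries_congr hfun
  rw [taylorPowerSeries_id, taylorPowerSeries_add (Finset.analyticAt_sum _ fun k _ => hterm k)
    ((hF.pow _).mul hRF), taylorPowerSeries_sum _ fun k _ => hterm k,
    taylorPowerSeries_mul (hF.pow _) hRF, taylorPowerSeries_pow hF] at hser
  simp_rw [fun k => taylorPowerSeries_mul (f := fun _ => iteratedDeriv k G 0 / (k ! : ℝ))
    analyticAt_const (hF.pow k), taylorPowerSeries_const, taylorPowerSeries_pow hF] at hser
  have hmain := lagrange_inversion_partialBell (taylorPowerSeries F) _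
    (by rw [← coeff_zero_eq_constantCoeff_apply, coeff_taylorPowerSeries]; simp [hF0])
    (deriv F 0) hF' (by rw [coeff_taylorPowerSeries]; simp) c
    (fun i hi => by
      rw [coeff_taylorPowerSeries, hc i hi, Nat.factorial_succ]
      push_cast
      have : (i ! : ℝ) ≠ 0 := by positivity
      have : (i : ℝ) + 1 ≠ 0 := by positivity
      field_simp)
    _ n hser
  rw [← hmain]
  have : ((n + 1)! : ℝ) ≠ 0 := by positivity
  field_simp

/-- The derivatives of a local inverse of an analytic function. -/
theorem iteratedDeriv_leftInverse {f g : ℝ → ℝ} {a : ℝ} (hf : AnalyticAt ℝ f a)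
    (hg : AnalyticAt ℝ g (f a)) (hf' : deriv f a ≠ 0)
    (hgf : ∀ᶠ z in 𝓝 a, g (f z) = z) (c : ℕ → ℝ)
    (hc : ∀ i, i ≠ 0 → iteratedDeriv (i + 1) f a = deriv f a * ((i + 1) * c i)) (n : ℕ) :
    iteratedDeriv (n + 1) g (f a) = (deriv f a)⁻¹ ^ (n + 1) * ∑ k ∈ Finset.range (n + 1),
      (-1 : ℝ) ^ k * ((n + 1).ascFactorial k : ℝ) * partialBell n k c := by
  have hFd (i : ℕ) : iteratedDeriv (i + 1) (fun z => -f a + f (a + z)) 0 =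
      iteratedDeriv (i + 1) f a := by
    rw [iteratedDeriv_const_add (Nat.succ_pos i), iteratedDeriv_comp_const_add]; simp
  have hFd0 : deriv (fun z => -f a + f (a + z)) 0 = deriv f a := by
    simpa [iteratedDeriv_one] using hFd 0
  have hFan : AnalyticAt ℝ (fun z => -f a + f (a + z)) 0 := by
    refine analyticAt_const.add (AnalyticAt.fun_comp (g := f) (by simpa using hf) ?_)
    exact analyticAt_const.add analyticAt_id
  have hGan : AnalyticAt ℝ (fun w => -a + g (f a + w)) 0 := by
    refine analyticAt_const.add (AnalyticAt.fun_comp (g := g) (by simpa using hg) ?_)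
    exact analyticAt_const.add analyticAt_id
  have hev : ∀ᶠ z in 𝓝 (0 : ℝ), -a + g (f a + (-f a + f (a + z))) = z := by
    have ht : Filter.Tendsto (fun z : ℝ => a + z) (𝓝 0) (𝓝 a) := by
      simpa using (continuous_const_add a).tendsto 0
    filter_upwards [ht.eventually hgf] with z hz
    rw [add_neg_cancel_left, hz, neg_add_cancel_left]
  have := iteratedDeriv_leftInverse_zero hFan hGan (by simp) (by rwa [hFd0]) hev c
    (fun i hi => by rw [hFd, hFd0, hc i hi]) n
  rw [iteratedDeriv_const_add (Nat.succ_pos n), iteratedDeriv_comp_const_add, hFd0] at this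
  simpa using this

end TaylorSeries

/-! ### The conditional laws as an exponential family -/

section CondLaw

theorem condLaw_eq_tilted (P : Measure ℝ) {σ : ℝ≥0} (hσ : 0 < σ) (y : ℝ) :
    condLaw P σ y = P.tilted fun x => -(y - x) ^ 2 / (2 * (σ : ℝ) ^ 2) := by
  rw [condLaw, Measure.tilted]
  congr 1
  funext x
  have hc : (Real.sqrt (2 * Real.pi * (σ : ℝ) ^ 2))⁻¹ ≠ 0 := by positivity
  simp only [outputDensity, gaussianPDFReal, NNReal.coe_pow, integral_const_mul]
  rw [mul_div_mul_left _ _ hc]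

variable (P : Measure ℝ) [IsProbabilityMeasure P] {σ : ℝ≥0}

theorem integrable_exp_neg_sq (σ : ℝ≥0) (y : ℝ) :
    Integrable (fun x => Real.exp (-(y - x) ^ 2 / (2 * (σ : ℝ) ^ 2))) P := by
  refine Integrable.of_bound (by fun_prop) 1 (Filter.Eventually.of_forall fun x => ?_)
  rw [Real.norm_of_nonneg (Real.exp_pos _).le, Real.exp_le_one_iff, neg_div]
  have : 0 ≤ (y - x) ^ 2 / (2 * (σ : ℝ) ^ 2) := by positivity
  linarith

theorem condLaw_eq_condLaw_zero_tilted (hσ : 0 < σ) (y : ℝ) :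
    condLaw P σ y = (condLaw P σ 0).tilted fun x => y / (σ : ℝ) ^ 2 * id x := by
  have hprob := isProbabilityMeasure_condLaw P hσ y
  -- The exponents differ by a term constant in `x`, which normalisation removes.
  have h2 : (fun x => -(0 - x) ^ 2 / (2 * (σ : ℝ) ^ 2)) + (fun x => y / (σ : ℝ) ^ 2 * id x) =
      (fun x => -(y - x) ^ 2 / (2 * (σ : ℝ) ^ 2)) + fun _ => y ^ 2 / (2 * (σ : ℝ) ^ 2) := by
    funext x
    have : (σ : ℝ) ≠ 0 := by positivity
    simp only [Pi.add_apply, id]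
    field_simp
    ring
  rw [condLaw_eq_tilted P hσ 0, tilted_tilted (integrable_exp_neg_sq P σ 0), h2,
    ← tilted_tilted (integrable_exp_neg_sq P σ y), ← condLaw_eq_tilted P hσ y, tilted_const]

theorem integrableExpSet_condLaw (hσ : 0 < σ) (y : ℝ) :
    integrableExpSet id (condLaw P σ y) = Set.univ :=
  Set.eq_univ_of_forall fun t => integrable_exp_condLaw P hσ y t

theorem mem_interior_integrableExpSet_condLaw (hσ : 0 < σ) (y t : ℝ) :
    t ∈ interior (integrableExpSet id (condLaw P σ y)) := by
  simp [integrableExpSet_condLaw P hσ]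

theorem analyticAt_cgf_condLaw (hσ : 0 < σ) (y t : ℝ) :
    AnalyticAt ℝ (cgf id (condLaw P σ y)) t :=
  analyticAt_cgf (mem_interior_integrableExpSet_condLaw P hσ y t)

/-- Tilting translates a cumulant generating function and subtracts a constant, so cumulants at
every `y` are derivatives of a single function. -/
theorem cgf_condLaw (hσ : 0 < σ) (y t : ℝ) :
    cgf id (condLaw P σ y) t =
      -cgf id (condLaw P σ 0) (y / (σ : ℝ) ^ 2) + cgf id (condLaw P σ 0) (y / (σ : ℝ) ^ 2 + t) := by
  have := isProbabilityMeasure_condLaw P hσ 0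
  have hpos (s : ℝ) : 0 < mgf id (condLaw P σ 0) s :=
    mgf_pos (integrable_exp_condLaw P hσ 0 s)
  have : mgf id (condLaw P σ y) t = mgf id (condLaw P σ 0) (y / (σ : ℝ) ^ 2 + t) /
      mgf id (condLaw P σ 0) (y / (σ : ℝ) ^ 2) := by
    rw [condLaw_eq_condLaw_zero_tilted P hσ y, mgf, integral_exp_tilted]
    simp only [mgf, Pi.add_apply, add_mul]
  rw [cgf, this, Real.log_div (hpos _).ne' (hpos _).ne', cgf, cgf]
  ring

theorem condCumulant_eq (hσ : 0 < σ) (y : ℝ) {k : ℕ} (hk : 0 < k) :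
    condCumulant P σ y k = iteratedDeriv k (cgf id (condLaw P σ 0)) (y / (σ : ℝ) ^ 2) := by
  rw [condCumulant, show cgf id (condLaw P σ y) = _ from funext (cgf_condLaw P hσ y),
    iteratedDeriv_const_add hk, iteratedDeriv_comp_const_add]
  simp

theorem condMean_eq (hσ : 0 < σ) :
    condMean P σ = fun y => deriv (cgf id (condLaw P σ 0)) (((σ : ℝ) ^ 2)⁻¹ * y) := by
  funext y
  rw [condMean, condLaw_eq_condLaw_zero_tilted P hσ y, mul_comm, ← div_eq_mul_inv]
  exact integral_tilted_mul_self (mem_interior_integrableExpSet_condLaw P hσ 0 _)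

theorem analyticAt_condMean (hσ : 0 < σ) (y : ℝ) : AnalyticAt ℝ (condMean P σ) y := by
  rw [condMean_eq P hσ]
  exact AnalyticAt.fun_comp (g := deriv (cgf id (condLaw P σ 0)))
    (analyticAt_cgf_condLaw P hσ 0 _).deriv (analyticAt_const.mul analyticAt_id)

/-- Each derivative in `y` raises the cumulant order by one and costs a factor `σ⁻²` by the chain
rule. -/
theorem iteratedDeriv_condMean (hσ : 0 < σ) (y : ℝ) (n : ℕ) :
    iteratedDeriv n (condMean P σ) y = condCumulant P σ y (n + 1) / (σ : ℝ) ^ (2 * n) := by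
  have hcd : ContDiff ℝ n (deriv (cgf id (condLaw P σ 0))) :=
    contDiff_iff_contDiffAt.2 fun t => (analyticAt_cgf_condLaw P hσ 0 t).deriv.contDiffAt
  rw [condMean_eq P hσ, iteratedDeriv_comp_const_mul hcd, condCumulant_eq P hσ y n.succ_pos,
    iteratedDeriv_succ', div_eq_inv_mul y]
  dsimp only
  rw [inv_pow, ← pow_mul, div_eq_inv_mul]

theorem deriv_condMean (hσ : 0 < σ) (y : ℝ) :
    deriv (condMean P σ) y = condCumulant P σ y 2 / (σ : ℝ) ^ 2 := by
  simpa [iteratedDeriv_one] using iteratedDeriv_condMean P hσ y 1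

/-- The second cumulant is the conditional variance. Were it zero, the identity would be constant
almost everywhere for the tilted law, hence for `P`, since the tilting density is positive. -/
theorem condCumulant_two_pos (hσ : 0 < σ) (hP : ¬ ∃ c : ℝ, id =ᵐ[P] fun _ => c) (y : ℝ) :
    0 < condCumulant P σ y 2 := by
  have := isProbabilityMeasure_condLaw P hσ y
  have hmem := mem_interior_integrableExpSet_condLaw P hσ 0 (y / (σ : ℝ) ^ 2)
  have hL2 : MemLp id 2 (condLaw P σ y) := by
    rw [condLaw_eq_condLaw_zero_tilted P hσ y]
    exact memLp_tilted_mul hmem 2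
  have hvar : condCumulant P σ y 2 = variance id (condLaw P σ y) := by
    rw [condCumulant_eq P hσ y two_pos, ← variance_tilted_mul hmem,
      ← condLaw_eq_condLaw_zero_tilted P hσ y]
  rw [hvar]
  refine (variance_nonneg _ _).lt_of_ne' fun h0 => hP ⟨∫ x, x ∂condLaw P σ y, ?_⟩
  have hac : P ≪ condLaw P σ y := by
    rw [condLaw_eq_tilted P hσ y]
    exact absolutelyContinuous_tilted (integrable_exp_neg_sq P σ y)
  refine hac.ae_eq ((evariance_eq_zero_iff aemeasurable_id).1 ?_)
  rw [← hL2.ofReal_variance_eq, h0, ENNReal.ofReal_zero]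

theorem strictMono_condMean (hσ : 0 < σ) (hP : ¬ ∃ c : ℝ, id =ᵐ[P] fun _ => c) :
    StrictMono (condMean P σ) :=
  strictMono_of_deriv_pos fun y => by
    rw [deriv_condMean P hσ]
    have := condCumulant_two_pos P hσ hP y
    positivity

end CondLaw

/-! ### Bayes' formula as a disintegration -/

section Bayes

variable (P : Measure ℝ) [IsProbabilityMeasure P] {σ : ℝ≥0}

theorem measurable_outputDensity (σ : ℝ≥0) : Measurable (outputDensity P σ) := by
  have : StronglyMeasurable (Function.uncurry fun y x : ℝ => gaussianPDFReal x (σ ^ 2) y) :=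
    (measurable_uncurry_gaussianPDFReal.comp
      (measurable_snd.prodMk (measurable_const.prodMk measurable_fst))).stronglyMeasurable
  exact (this.integral_prod_right (ν := P)).measurable

/-- The kernel `y ↦ P_{X|Y=y}`. -/
noncomputable def condLawKernel (σ : ℝ≥0) : Kernel ℝ ℝ :=
  Kernel.withDensity (Kernel.const ℝ P)
    fun y x => ENNReal.ofReal (gaussianPDFReal x (σ ^ 2) y / outputDensity P σ y)

theorem measurable_gaussianPDFReal_div_outputDensity (σ : ℝ≥0) :
    Measurable (Function.uncurry fun y x : ℝ =>
      ENNReal.ofReal (gaussianPDFReal x (σ ^ 2) y / outputDensity P σ y)) :=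
  ((measurable_uncurry_gaussianPDFReal.comp
    (measurable_snd.prodMk (measurable_const.prodMk measurable_fst))).div
      ((measurable_outputDensity P σ).comp measurable_fst)).ennreal_ofReal

theorem condLawKernel_apply (σ : ℝ≥0) (y : ℝ) : condLawKernel P σ y = condLaw P σ y := by
  rw [condLawKernel,
    Kernel.withDensity_apply _ (measurable_gaussianPDFReal_div_outputDensity P σ)]
  rfl

theorem isMarkovKernel_condLawKernel (hσ : 0 < σ) : IsMarkovKernel (condLawKernel P σ) :=
  ⟨fun y => by rw [condLawKernel_apply]; exact isProbabilityMeasure_condLaw P hσ y⟩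

theorem lintegral_gaussianReal_const_add (hσ : 0 < σ) {f : ℝ → ℝ≥0∞} (hf : Measurable f) (x : ℝ) :
    ∫⁻ n, f (x + n) ∂(gaussianReal 0 (σ ^ 2)) =
      ∫⁻ y, ENNReal.ofReal (gaussianPDFReal x (σ ^ 2) y) * f y := by
  have hv : σ ^ 2 ≠ 0 := pow_ne_zero 2 hσ.ne'
  rw [← lintegral_map hf (measurable_const_add x), gaussianReal_map_const_add, zero_add,
    gaussianReal_of_var_ne_zero _ hv, lintegral_withDensity_eq_lintegral_mul _
      (measurable_gaussianPDF _ _) hf]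
  rfl

/-- The joint law of `(X + N, X)`, tested on nonnegative functions. -/
theorem lintegral_map_add_prod (hσ : 0 < σ) {f : ℝ × ℝ → ℝ≥0∞} (hf : Measurable f) :
    ∫⁻ z, f z ∂((P.prod (gaussianReal 0 (σ ^ 2))).map fun z => (z.1 + z.2, z.1)) =
      ∫⁻ y, ∫⁻ x, ENNReal.ofReal (gaussianPDFReal x (σ ^ 2) y) * f (y, x) ∂P := by
  have hg : Measurable fun z : ℝ × ℝ => ENNReal.ofReal (gaussianPDFReal z.1 (σ ^ 2) z.2) :=
    (measurable_uncurry_gaussianPDFReal.comp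
      (measurable_fst.prodMk (measurable_const.prodMk measurable_snd))).ennreal_ofReal
  rw [lintegral_map hf (by fun_prop), lintegral_prod _ (by fun_prop)]
  simp_rw [fun x => lintegral_gaussianReal_const_add hσ
    (f := fun y => f (y, x)) (by fun_prop) x]
  rw [lintegral_lintegral_swap]
  exact (hg.mul (hf.comp measurable_swap)).aemeasurable

theorem map_add_prod_gaussianReal (hσ : 0 < σ) :
    (P.prod (gaussianReal 0 (σ ^ 2))).map (fun z => z.1 + z.2) =
      volume.withDensity fun y => ENNReal.ofReal (outputDensity P σ y) := by
  have hcomp : (P.prod (gaussianReal 0 (σ ^ 2))).map (fun z => z.1 + z.2) =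
      ((P.prod (gaussianReal 0 (σ ^ 2))).map fun z => (z.1 + z.2, z.1)).map Prod.fst := by
    rw [Measure.map_map measurable_fst (by fun_prop)]; rfl
  refine Measure.ext_of_lintegral _ fun f hf => ?_
  rw [hcomp, lintegral_map hf measurable_fst, lintegral_map_add_prod P hσ (by fun_prop),
    lintegral_withDensity_eq_lintegral_mul _ (measurable_outputDensity P σ).ennreal_ofReal hf]
  refine lintegral_congr fun y => ?_
  dsimp only
  rw [lintegral_mul_const _ (measurable_gaussianPDFReal_left σ y).ennreal_ofReal, Pi.mul_apply,
    outputDensity, ofReal_integral_eq_lintegral_ofReal (integrable_gaussianPDFReal_left P σ y)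
      (Filter.Eventually.of_forall fun x => gaussianPDFReal_nonneg _ _ _)]

/-- The factor `f_Y` of the output law cancels the denominator in Bayes' formula. By uniqueness of
disintegrations this identifies `condDistrib`. -/
theorem map_add_prod_eq_compProd (hσ : 0 < σ) :
    (P.prod (gaussianReal 0 (σ ^ 2))).map (fun z => (z.1 + z.2, z.1)) =
      (P.prod (gaussianReal 0 (σ ^ 2))).map (fun z => z.1 + z.2) ⊗ₘ condLawKernel P σ := by
  have := isMarkovKernel_condLawKernel P hσ
  have : IsProbabilityMeasure
      ((P.prod (gaussianReal 0 (σ ^ 2))).map (fun z : ℝ × ℝ => z.1 + z.2)) :=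
    Measure.isProbabilityMeasure_map (by fun_prop)
  refine Measure.ext_of_lintegral _ fun f hf => ?_
  rw [lintegral_map_add_prod P hσ hf, Measure.lintegral_compProd hf, map_add_prod_gaussianReal P hσ,
    lintegral_withDensity_eq_lintegral_mul _ (measurable_outputDensity P σ).ennreal_ofReal
      hf.lintegral_kernel_prod_right']
  refine lintegral_congr fun y => ?_
  have hfy : Measurable fun x => f (y, x) := by fun_prop
  have hd := (measurable_gaussianPDFReal_left σ y).div_const (outputDensity P σ y)
  rw [Pi.mul_apply, condLawKernel_apply, condLaw,
    lintegral_withDensity_eq_lintegral_mul _ hd.ennreal_ofReal hfy,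
    ← lintegral_const_mul _ (hd.ennreal_ofReal.mul hfy)]
  refine lintegral_congr fun x => ?_
  have hpos := outputDensity_pos P hσ y
  rw [Pi.mul_apply, ← mul_assoc, ← ENNReal.ofReal_mul hpos.le, mul_div_cancel₀ _ hpos.ne']

theorem condDistrib_ae_eq_condLaw {Ω : Type*} [MeasurableSpace Ω] (μ : Measure Ω)
    [IsProbabilityMeasure μ] {X N : Ω → ℝ} (hσ : 0 < σ) (hX : AEMeasurable X μ)
    (hN : HasLaw N (gaussianReal 0 (σ ^ 2)) μ) (hXN : IndepFun X N μ) :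
    ∀ᵐ y ∂(μ.map (X + N)), condDistrib X (X + N) μ y = condLaw (μ.map X) σ y := by
  have hPX : IsProbabilityMeasure (μ.map X) := Measure.isProbabilityMeasure_map hX
  have := isMarkovKernel_condLawKernel (μ.map X) hσ
  have hXNm : AEMeasurable (fun ω => (X ω, N ω)) μ := hX.prodMk hN.aemeasurable
  have hprod : μ.map (fun ω => (X ω, N ω)) = (μ.map X).prod (gaussianReal 0 (σ ^ 2)) := by
    rw [(indepFun_iff_map_prod_eq_prod_map_map hX hN.aemeasurable).1 hXN, hN.map_eq]
  have hY : μ.map (X + N) =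
      ((μ.map X).prod (gaussianReal 0 (σ ^ 2))).map fun z => z.1 + z.2 := by
    rw [← hprod, AEMeasurable.map_map_of_aemeasurable (by fun_prop) hXNm]; rfl
  have hYX : μ.map (fun ω => ((X + N) ω, X ω)) =
      ((μ.map X).prod (gaussianReal 0 (σ ^ 2))).map fun z => (z.1 + z.2, z.1) := by
    rw [← hprod, AEMeasurable.map_map_of_aemeasurable (by fun_prop) hXNm]; rfl
  have h := condDistrib_ae_eq_of_measure_eq_compProd (X + N) hX (κ := condLawKernel (μ.map X) σ)
    (by rw [hYX, hY, map_add_prod_eq_compProd _ hσ])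
  filter_upwards [h] with y hy
  rw [hy, condLawKernel_apply]

end Bayes

/-! ### The inverse of the conditional mean -/

section Inverse

/-- Allowing `k = 0` merges the two cases: that term is `B_{0,0} = 1` for the first coefficient and
zero for later ones. -/
theorem invCoeff_succ (P : Measure ℝ) (σ : ℝ≥0) (a : ℝ) (n : ℕ) :
    invCoeff P σ a (n + 1) = ((σ : ℝ) ^ 2 / condCumulant P σ a 2) ^ (n + 1) *
      ∑ k ∈ Finset.range (n + 1), (-1 : ℝ) ^ k * ((n + 1).ascFactorial k : ℝ) *
        partialBell n k (invAux P σ a) := by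
  rw [invCoeff]
  split_ifs with h
  · obtain rfl : n = 0 := by omega
    simp [partialBell_zero_zero]
  · have hn : n ≠ 0 := by omega
    rw [Nat.add_sub_cancel, Finset.range_eq_Ico, Finset.sum_eq_sum_Ico_succ_bot n.succ_pos,
      partialBell_zero_right hn, mul_zero, zero_add]
    rfl

variable (P : Measure ℝ) [IsProbabilityMeasure P] {σ : ℝ≥0}

theorem leftInverse_invFun_condMean (hσ : 0 < σ) (hP : ¬ ∃ c : ℝ, id =ᵐ[P] fun _ => c) :
    Function.LeftInverse (Function.invFun (condMean P σ)) (condMean P σ) :=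
  Function.leftInverse_invFun (strictMono_condMean P hσ hP).injective

theorem deriv_condMean_ne_zero (hσ : 0 < σ) (hP : ¬ ∃ c : ℝ, id =ᵐ[P] fun _ => c) (a : ℝ) :
    deriv (condMean P σ) a ≠ 0 := by
  rw [deriv_condMean P hσ]
  have := condCumulant_two_pos P hσ hP a
  positivity

theorem analyticAt_invFun_condMean (hσ : 0 < σ) (hP : ¬ ∃ c : ℝ, id =ᵐ[P] fun _ => c) (a : ℝ) :
    AnalyticAt ℝ (Function.invFun (condMean P σ)) (condMean P σ a) := by
  -- Composition on the right with a locally invertible analytic map preserves and reflects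
  -- analyticity, and here the composite is the identity.
  rw [← analyticAt_comp_iff_of_deriv_ne_zero (analyticAt_condMean P hσ a)
    (deriv_condMean_ne_zero P hσ hP a), (leftInverse_invFun_condMean P hσ hP).comp_eq_id]
  exact analyticAt_id

theorem iteratedDeriv_invFun_condMean (hσ : 0 < σ) (hP : ¬ ∃ c : ℝ, id =ᵐ[P] fun _ => c) (a : ℝ)
    (n : ℕ) :
    iteratedDeriv (n + 1) (Function.invFun (condMean P σ)) (condMean P σ a) =
      invCoeff P σ a (n + 1) := by
  have hκ := condCumulant_two_pos P hσ hP a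
  rw [iteratedDeriv_leftInverse (analyticAt_condMean P hσ a) (analyticAt_invFun_condMean P hσ hP a)
    (deriv_condMean_ne_zero P hσ hP a)
    (Filter.Eventually.of_forall (leftInverse_invFun_condMean P hσ hP)) (invAux P σ a)
    (fun i _ => ?_) n, invCoeff_succ, deriv_condMean P hσ, inv_div]
  rw [iteratedDeriv_condMean P hσ, deriv_condMean P hσ, invAux, mul_add, pow_add]
  have : (σ : ℝ) ≠ 0 := by positivity
  have : (i : ℝ) + 1 ≠ 0 := by positivity
  field_simp

theorem hasSum_invFun_condMean (hσ : 0 < σ) (hP : ¬ ∃ c : ℝ, id =ᵐ[P] fun _ => c) (a : ℝ) :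
    ∃ τ : ℝ, 0 < τ ∧ ∀ x : ℝ, |x - condMean P σ a| < τ →
      x ∈ Set.range (condMean P σ) ∧
      HasSum (fun m : ℕ => invCoeff P σ a (m + 1) *
          ((x - condMean P σ a) ^ (m + 1) / ((m + 1)! : ℝ)))
        (Function.invFun (condMean P σ) x - a) := by
  have hrange : ∀ᶠ x in nhds (condMean P σ a), x ∈ Set.range (condMean P σ) := by
    -- A nonzero strict derivative makes the map locally open, so the range is a neighbourhood and
    -- the arbitrary values of `Function.invFun` off the range play no role.
    have hmap := (analyticAt_condMean P hσ a).hasStrictDerivAt.map_nhds_eq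
      (deriv_condMean_ne_zero P hσ hP a)
    rw [← hmap]
    exact Filter.mem_map.2 (Filter.univ_mem' fun x => Set.mem_range_self x)
  have hsum := (hasFPowerSeriesAt_iff'.1 (analyticAt_invFun_condMean P hσ hP a).hasFPowerSeriesAt)
  obtain ⟨τ, hτ, h⟩ := Metric.eventually_nhds_iff.1 (hrange.and hsum)
  refine ⟨τ, hτ, fun x hx => ⟨(h (by rwa [Real.dist_eq])).1, ?_⟩⟩
  have hx' := (h (by rwa [Real.dist_eq])).2
  -- Splits off the constant term, which is `a`.
  rw [← hasSum_nat_add_iff' 1] at hx'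
  simp only [FormalMultilinearSeries.coeff_ofScalars, iteratedDeriv_invFun_condMean P hσ hP,
    Finset.sum_range_one, iteratedDeriv_zero, leftInverse_invFun_condMean P hσ hP a, smul_eq_mul,
    pow_zero, Nat.factorial_zero, Nat.cast_one, div_one, one_mul] at hx'
  convert! hx' using 2 with m
  ring

end Inverse

theorem mainTheorem9 {Ω : Type*} [MeasurableSpace Ω] (μ : Measure Ω) [IsProbabilityMeasure μ]
    (X N Y : Ω → ℝ) (σ : ℝ≥0) (hσ : 0 < σ)
    (hX : AEMeasurable X μ)
    (hN : HasLaw N (gaussianReal 0 (σ ^ 2)) μ)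
    (hXN : IndepFun X N μ)
    (hY : Y = X + N)
    (hconst : ¬ ∃ c : ℝ, X =ᵐ[μ] fun _ => c) :
    (∀ᵐ y ∂(μ.map Y), condDistrib X Y μ y = condLaw (μ.map X) σ y) ∧
    StrictMono (condMean (μ.map X) σ) ∧
    Function.LeftInverse (Function.invFun (condMean (μ.map X) σ)) (condMean (μ.map X) σ) ∧
    AnalyticOnNhd ℝ (Function.invFun (condMean (μ.map X) σ))
      (Set.range (condMean (μ.map X) σ)) ∧
    ∀ a : ℝ, 0 < condCumulant (μ.map X) σ a 2 ∧
      ∃ τ : ℝ, 0 < τ ∧ ∀ x : ℝ, |x - condMean (μ.map X) σ a| < τ →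
        x ∈ Set.range (condMean (μ.map X) σ) ∧
        HasSum
          (fun m : ℕ => invCoeff (μ.map X) σ a (m + 1) *
            ((x - condMean (μ.map X) σ a) ^ (m + 1) / ((m + 1)! : ℝ)))
          (Function.invFun (condMean (μ.map X) σ) x - a) := by
  subst hY
  have hprob : IsProbabilityMeasure (μ.map X) := Measure.isProbabilityMeasure_map hX
  have hP : ¬ ∃ c : ℝ, id =ᵐ[μ.map X] fun _ => c := fun ⟨c, hc⟩ =>
    hconst ⟨c, ae_of_ae_map hX hc⟩
  refine ⟨condDistrib_ae_eq_condLaw μ hσ hX hN hXN, strictMono_condMean _ hσ hP,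
    leftInverse_invFun_condMean _ hσ hP, ?_,
    fun a => ⟨condCumulant_two_pos _ hσ hP a, hasSum_invFun_condMean _ hσ hP a⟩⟩
  rintro _ ⟨a, rfl⟩
  exact analyticAt_invFun_condMean _ hσ hP a
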